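/- Let $A\in\mathbb{R}^{n\times n}$ be symmetric positive semidefinite with smallest eigenvalue $\alpha\ge 0$ and largest eigenvalue $L$, let $b\in\mathbb{R}^n$ and $\Delta>0$. Put $f(x)=\tfrac12x^TAx-b^Tx$, $B=\{x:\|x\|\le\Delta\}$ (Euclidean norm), $F=f+\mathrm{i}_B$, where $\mathrm{i}_B$ is $0$ on $B$ and $+\infty$ off $B$, and let $x^*$ be a (fixed) minimizer of $F$. The trust-region Lanczos method sets $r_0=p_0=b$ and $$\alpha_k=\frac{r_k^Tr_k}{p_k^TAp_k},\quad r_{k+1}=r_k-\alpha_kAp_k,\quad \beta_k=\frac{r_{k+1}^Tr_{k+1}}{r_k^Tr_k},\quad p_{k+1}=\beta_kp_k+r_{k+1},$$ where a quotient with zero denominator is read as $0$ (so that the method may be continued after it has reached an optimizer). Put $\mathcal V_k=\mathrm{span}\{p_0,\dots,p_{k-1}\}$. The iterates are $x_0=0$ and, for $k\ge1$, any $x_k\in\operatorname{argmin}\{f(x): x\in\mathcal V_k,\ \|x\|\le\Delta\}$. For $L>0$ let $G(x)=L\,\bigl(x-\mathrm{prox}_{\mathrm{i}_B/L}(x-\nabla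 f(x)/L)\bigr)$ be the prox-gradient mapping, where $\mathrm{prox}_{t\Psi}(v)=\operatorname{argmin}_w\{\Psi(w)+\|v-w\|^2/(2t)\}$, and $\bar z=z-G(z)/L$. Auxiliary sequences are sequences $(y_k),(z_k)$ with $y_0=z_0=x_0$ such that, for $k\ge1$, $y_k$ is the point of $\mathcal V_k$ closest to $x^*$, and $z_k\in\mathcal V_k$ satisfies $G(z_k)^T(y_k-z_k)\ge0$ and $F(\bar z_k)\le F(x_k)-\frac1{2L}\|G(z_k)\|^2$. Then the following hold. 1. (The method fits the idealized framework.) Let $L>0$. Then $f$ is $L$-smooth and $\alpha$-strongly convex (convex if $\alpha=0$), and $\mathrm{i}_B$ is closed, proper and convex. For all auxiliary sequences $(y_k),(z_k)$, with $\mathcal M_k=\mathcal V_k$: $z_0=x_0$, $\mathcal M_1\supseteq z_0+\mathrm{span}\{G(z_0)\}$, and for all $k\ge1$: $y_k=\operatorname{argmin}\{\|y-x^*\|^2:y\in\mathcal M_k\}$; $x_k\in\operatorname{argmin}\{F(x):x\in\mathcal M_k\}$; $z_k\in\mathcal M_k$, $G(z_k)^T(y_k-z_k)\ge0$ and $F(\bar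 z_k)\le F(x_k)-\frac1{2L}\|G(z_k)\|^2$; and $\mathcal M_{k+1}\supseteq z_k+\mathrm{span}\{y_k-z_k,G(z_k)\}$. Moreover, auxiliary sequences exist, and they can be chosen such that, in addition, for all $k\ge1$, $-G(z_k)^T(x_k-z_k)\le0$ and $\mathcal M_{k+1}$ contains $z_k+\mathrm{span}\{G(z_k)\}$, $y_k+\mathrm{span}\{G(z_k)\}$ and $x_k+\mathrm{span}\{G(x_k)\}$ (the framework for objectives that need not be strongly convex). 2. (Linear rate.) $F(x^*)$ and all $F(x_k)$ are finite, and if $\alpha>0$, then for all $k\ge1$, with $y_k$ the point of $\mathcal V_k$ closest to $x^*$, $$\|y_{k+1}-x^*\|^2+\frac{2(F(x_{k+1})-F(x^*))}{\alpha}\le\Bigl(1-\sqrt{\tfrac{\alpha}{L}}\Bigr)\Bigl(\|y_k-x^*\|^2+\frac{2(F(x_k)-F(x^*))}{\alpha}\Bigr).$$ 3. (Sublinear rate.) For all $k\ge1$, $$F(x_k)-F(x^*)\le\frac{2\bigl(L\|x^*\|^2+F(0)-F(x^*)\bigr)}{k(k+1)}.$$ -/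

import Mathlib

open scoped Gradient

noncomputable section

namespace TrustRegion

/-! ### Composite problems and the prox-gradient mapping -/

section Composite

variable {E : Type*} [NormedAddCommGroup E] [InnerProductSpace ℝ E]

/-- The composite objective `F = f + Ψ`, with `f` real valued and `Ψ` extended real valued. -/
def composite (f : E → ℝ) (Ψ : E → EReal) (x : E) : EReal := (f x : EReal) + Ψ x

/-- The indicator function of a set: `0` on the set and `+∞` off it. -/
def indicatorFn (S : Set E) (x : E) : EReal :=
  open Classical in if x ∈ S then 0 else ⊤

/-- The set of minimizers of a function over a set. -/
def argminOn {β : Type*} [Preorder β] (g : E → β) (S : Set E) : Set E :=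
  {x | x ∈ S ∧ ∀ w ∈ S, g x ≤ g w}

/-- The prox operator `prox_{tΨ}(x) = argmin_w { Ψ(w) + ‖x - w‖² / (2t) }`
(the unique minimizer, for `t > 0` and `Ψ` closed, proper and convex). -/
def prox (t : ℝ) (Ψ : E → EReal) (x : E) : E :=
  Classical.epsilon fun p =>
    p ∈ argminOn (fun w => Ψ w + ((‖x - w‖ ^ 2 / (2 * t) : ℝ) : EReal)) Set.univ

variable [CompleteSpace E]

/-- The prox-gradient mapping `G_t(x) = t⁻¹ (x - prox_{tΨ}(x - t ∇f(x)))`. -/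
def proxGrad (f : E → ℝ) (Ψ : E → EReal) (t : ℝ) (x : E) : E :=
  t⁻¹ • (x - prox t Ψ (x - t • ∇ f x))

/-- The forward-backward step `x̄ = x - G_{1/L}(x) / L`. -/
def fbStep (f : E → ℝ) (Ψ : E → EReal) (L : ℝ) (x : E) : E :=
  x - (1 / L) • proxGrad f Ψ (1 / L) x

/-- The standing assumptions on a composite problem `min f + Ψ`: `f` is `L`-smooth and
`α`-strongly convex (convex when `α = 0`), `Ψ` is closed, proper and convex, and `xs` is a
minimizer of `f + Ψ`. -/
structure IsCompositeProblem (f : E → ℝ) (Ψ : E → EReal) (α L : ℝ) (xs : E) : Prop where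
  L_pos : 0 < L
  differentiable : Differentiable ℝ f
  smooth : ∀ x w, ‖∇ f x - ∇ f w‖ ≤ L * ‖x - w‖
  strongConvex : StrongConvexOn Set.univ α f
  closed : IsClosed {p : E × ℝ | Ψ p.1 ≤ (p.2 : EReal)}
  ne_bot : ∀ x, Ψ x ≠ ⊥
  proper : ∃ x, Ψ x ≠ ⊤
  convex : Convex ℝ {p : E × ℝ | Ψ p.1 ≤ (p.2 : EReal)}
  minimizer : xs ∈ argminOn (composite f Ψ) Set.univ

/-- The sequences `M`, `x`, `y`, `z` are generated by the idealized algorithmic framework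
(strongly convex version). -/
structure IsIdealizedRun (f : E → ℝ) (Ψ : E → EReal) (L : ℝ) (xs : E)
    (M : ℕ → AffineSubspace ℝ E) (x y z : ℕ → E) : Prop where
  z_zero : z 0 = x 0
  M_one : AffineSubspace.mk' (z 0) (Submodule.span ℝ {proxGrad f Ψ (1 / L) (z 0)}) ≤ M 1
  y_mem : ∀ k, 1 ≤ k → y k ∈ argminOn (fun w => ‖w - xs‖ ^ 2) (M k : Set E)
  x_mem : ∀ k, 1 ≤ k → x k ∈ argminOn (composite f Ψ) (M k : Set E)
  z_mem : ∀ k, 1 ≤ k → z k ∈ M k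
  z_inner : ∀ k, 1 ≤ k → 0 ≤ inner ℝ (proxGrad f Ψ (1 / L) (z k)) (y k - z k)
  z_descent : ∀ k, 1 ≤ k → composite f Ψ (fbStep f Ψ L (z k)) ≤
    composite f Ψ (x k) - ((1 / (2 * L) * ‖proxGrad f Ψ (1 / L) (z k)‖ ^ 2 : ℝ) : EReal)
  M_succ : ∀ k, 1 ≤ k →
    AffineSubspace.mk' (z k)
      (Submodule.span ℝ {y k - z k, proxGrad f Ψ (1 / L) (z k)}) ≤ M (k + 1)

/-- The sequences `M`, `x`, `y`, `z` are generated by the idealized algorithmic framework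
in its version for objectives that need not be strongly convex. -/
structure IsIdealizedRunConvex (f : E → ℝ) (Ψ : E → EReal) (L : ℝ) (xs : E)
    (M : ℕ → AffineSubspace ℝ E) (x y z : ℕ → E) : Prop where
  z_zero : z 0 = x 0
  M_one : AffineSubspace.mk' (z 0) (Submodule.span ℝ {proxGrad f Ψ (1 / L) (z 0)}) ≤ M 1
  y_mem : ∀ k, 1 ≤ k → y k ∈ argminOn (fun w => ‖w - xs‖ ^ 2) (M k : Set E)
  x_mem : ∀ k, 1 ≤ k → x k ∈ argminOn (composite f Ψ) (M k : Set E)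
  z_mem : ∀ k, 1 ≤ k → z k ∈ M k
  z_inner_y : ∀ k, 1 ≤ k → 0 ≤ inner ℝ (proxGrad f Ψ (1 / L) (z k)) (y k - z k)
  z_inner_x : ∀ k, 1 ≤ k → -inner ℝ (proxGrad f Ψ (1 / L) (z k)) (x k - z k) ≤ 0
  M_succ_z : ∀ k, 1 ≤ k →
    AffineSubspace.mk' (z k) (Submodule.span ℝ {proxGrad f Ψ (1 / L) (z k)}) ≤ M (k + 1)
  M_succ_y : ∀ k, 1 ≤ k →
    AffineSubspace.mk' (y k) (Submodule.span ℝ {proxGrad f Ψ (1 / L) (z k)}) ≤ M (k + 1)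
  M_succ_x : ∀ k, 1 ≤ k →
    AffineSubspace.mk' (x k) (Submodule.span ℝ {proxGrad f Ψ (1 / L) (x k)}) ≤ M (k + 1)

end Composite

/-! ### The trust-region problem and the trust-region Lanczos method -/

section Lanczos

variable {n : ℕ}

/-- `f(x) = ½ xᵀ A x - bᵀ x`. -/
def quad (A : Matrix (Fin n) (Fin n) ℝ) (b : EuclideanSpace ℝ (Fin n))
    (x : EuclideanSpace ℝ (Fin n)) : ℝ :=
  1 / 2 * inner ℝ x (A.toEuclideanLin x) - inner ℝ b x

/-- The feasible region `B = {x : ‖x‖ ≤ Δ}`. -/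
def feasible (n : ℕ) (Δ : ℝ) : Set (EuclideanSpace ℝ (Fin n)) := Metric.closedBall 0 Δ

/-- The composite objective `F = f + i_B`. -/
def objective (A : Matrix (Fin n) (Fin n) ℝ) (b : EuclideanSpace ℝ (Fin n)) (Δ : ℝ) :
    EuclideanSpace ℝ (Fin n) → EReal :=
  composite (quad A b) (indicatorFn (feasible n Δ))

/-- The step length `α_k = r_kᵀ r_k / p_kᵀ A p_k`. -/
def cgStep (A : Matrix (Fin n) (Fin n) ℝ) (r p : EuclideanSpace ℝ (Fin n)) : ℝ :=
  inner ℝ r r / inner ℝ p (A.toEuclideanLin p)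

/-- The pair `(r_k, p_k)` of residual and conjugate direction: `r_0 = p_0 = b`,
`r_{k+1} = r_k - α_k A p_k`, `β_k = r_{k+1}ᵀ r_{k+1} / r_kᵀ r_k`, `p_{k+1} = β_k p_k + r_{k+1}`.
A quotient with denominator zero is read as zero. For positive semidefinite `A` the first such
quotient can occur only at an index `k` (in `α_k`) for which `V_{k+1} = span {p_0, …, p_k}` is
already the full Krylov space, so that `x_{k+1}` is optimal; the subspaces `krylov A b j` below
stay constant for `j ≥ k + 1`, so the iteration simply continues at the optimizer. -/
def cgState (A : Matrix (Fin n) (Fin n) ℝ) (b : EuclideanSpace ℝ (Fin n)) :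
    ℕ → EuclideanSpace ℝ (Fin n) × EuclideanSpace ℝ (Fin n)
  | 0 => (b, b)
  | k + 1 =>
    let r := (cgState A b k).1
    let p := (cgState A b k).2
    let r' := r - cgStep A r p • A.toEuclideanLin p
    (r', (inner ℝ r' r' / inner ℝ r r) • p + r')

/-- The conjugate direction `p_k`. -/
def cgDir (A : Matrix (Fin n) (Fin n) ℝ) (b : EuclideanSpace ℝ (Fin n)) (k : ℕ) :
    EuclideanSpace ℝ (Fin n) := (cgState A b k).2

/-- The subspace `V_k = span {p_0, …, p_{k-1}}`. -/
def krylov (A : Matrix (Fin n) (Fin n) ℝ) (b : EuclideanSpace ℝ (Fin n)) (k : ℕ) :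
    Submodule ℝ (EuclideanSpace ℝ (Fin n)) :=
  Submodule.span ℝ (cgDir A b '' {j | j < k})

/-- `x` is a sequence of iterates of the trust-region Lanczos method: `x_0 = 0`, and for `k ≥ 1`
`x_k` minimizes `½ xᵀ A x - bᵀ x` over the `x ∈ V_k` with `‖x‖ ≤ Δ`. -/
def IsLanczosRun (A : Matrix (Fin n) (Fin n) ℝ) (b : EuclideanSpace ℝ (Fin n)) (Δ : ℝ)
    (x : ℕ → EuclideanSpace ℝ (Fin n)) : Prop :=
  x 0 = 0 ∧ ∀ k, 1 ≤ k → x k ∈ argminOn (quad A b) {w | w ∈ krylov A b k ∧ ‖w‖ ≤ Δ}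

/-- The auxiliary vectors `y_k`, `z_k` of the analysis: `y_0 = z_0 = x_0`, and for `k ≥ 1`
`y_k` is the point of `V_k` closest to `xs`, while `z_k ∈ V_k` is any vector with
`G_{1/L}(z_k)ᵀ(y_k - z_k) ≥ 0` and `F(z̄_k) ≤ F(x_k) - ‖G_{1/L}(z_k)‖² / (2L)`. -/
structure IsAuxiliary (A : Matrix (Fin n) (Fin n) ℝ) (b : EuclideanSpace ℝ (Fin n)) (Δ L : ℝ)
    (xs : EuclideanSpace ℝ (Fin n)) (x y z : ℕ → EuclideanSpace ℝ (Fin n)) : Prop where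
  y_zero : y 0 = z 0
  z_zero : z 0 = x 0
  y_mem : ∀ k, 1 ≤ k → y k ∈ argminOn (fun w => ‖w - xs‖ ^ 2) (krylov A b k : Set _)
  z_mem : ∀ k, 1 ≤ k → z k ∈ krylov A b k
  z_inner : ∀ k, 1 ≤ k → 0 ≤
    inner ℝ (proxGrad (quad A b) (indicatorFn (feasible n Δ)) (1 / L) (z k)) (y k - z k)
  z_descent : ∀ k, 1 ≤ k →
    objective A b Δ (fbStep (quad A b) (indicatorFn (feasible n Δ)) L (z k)) ≤
      objective A b Δ (x k) - ((1 / (2 * L) *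
        ‖proxGrad (quad A b) (indicatorFn (feasible n Δ)) (1 / L) (z k)‖ ^ 2 : ℝ) : EReal)

end Lanczos

end TrustRegion

end

/-! Two structural facts drive everything. The spaces `V_k = krylov A b k` are nested with `A V_k ⊆
V_{k+1}` and `b ∈ V_1`, and projection onto a ball centered at the origin maps every linear subspace
into itself. Hence prox-gradient steps from points of `V_k` stay in `V_{k+1}` (`fbStep_mem_krylov`,
`proxGrad_mem_krylov`). Since `x_{k+1}` and `y_{k+1}` are optimal over `V_{k+1}`, they are at least
as good as any accelerated proximal-gradient update made from `V_k`.

The point `z_k` comes from the intermediate value theorem on the segment from `x_k` to `y_k`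
(`exists_segment_inner_nonneg`); the prox-gradient inequality (`proxGrad_inequality`) tested at
`x_k` then yields the descent condition. Tested at the minimizer and combined with that descent, the
same inequality makes a potential in `‖y_k - x*‖²` and `F(x_k) - F(x*)` contract
(`linear_rate_step`) or not increase (`sublinear_rate_step`). The sublinear rate reaches `L = 0` by
a limit from above. -/

namespace TrustRegion

/-! ### Indicator functions and projection as a prox operator -/

section Prox

variable {E : Type*}

lemma indicatorFn_of_mem {S : Set E} {x : E} (hx : x ∈ S) : indicatorFn S x = 0 := by
  simp [indicatorFn, hx]

lemma indicatorFn_of_notMem {S : Set E} {x : E} (hx : x ∉ S) : indicatorFn S x = ⊤ := by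
  simp [indicatorFn, hx]

lemma composite_indicatorFn_of_mem (f : E → ℝ) {S : Set E} {x : E} (hx : x ∈ S) :
    composite f (indicatorFn S) x = f x := by
  simp [composite, indicatorFn_of_mem hx]

lemma composite_indicatorFn_of_notMem (f : E → ℝ) {S : Set E} {x : E} (hx : x ∉ S) :
    composite f (indicatorFn S) x = ⊤ := by
  simp [composite, indicatorFn_of_notMem hx]

/-- The minimizers of `f + i_S` over `T` are those of `f` over `T ∩ S`, once this set is
nonempty. -/
lemma mem_argminOn_composite_indicatorFn_iff (f : E → ℝ) {S T : Set E} (hne : (T ∩ S).Nonempty)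
    (x : E) : x ∈ argminOn (composite f (indicatorFn S)) T ↔ x ∈ argminOn f (T ∩ S) := by
  constructor
  · rintro ⟨hxT, hmin⟩
    obtain ⟨w, hwT, hwS⟩ := hne
    have hxS : x ∈ S := by
      by_contra hxS
      have := hmin w hwT
      rw [composite_indicatorFn_of_mem f hwS, composite_indicatorFn_of_notMem f hxS] at this
      exact absurd this (by simp)
    refine ⟨⟨hxT, hxS⟩, fun v hv => ?_⟩
    have := hmin v hv.1
    rw [composite_indicatorFn_of_mem f hv.2, composite_indicatorFn_of_mem f hxS] at this
    exact_mod_cast this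
  · rintro ⟨⟨hxT, hxS⟩, hmin⟩
    refine ⟨hxT, fun w hw => ?_⟩
    by_cases hwS : w ∈ S
    · rw [composite_indicatorFn_of_mem f hxS, composite_indicatorFn_of_mem f hwS]
      exact_mod_cast hmin w ⟨hw, hwS⟩
    · simp [composite_indicatorFn_of_notMem f hwS]

variable [NormedAddCommGroup E] [InnerProductSpace ℝ E]

/-- A point of a convex set that is closest to `v` satisfies the obtuse angle criterion. -/
lemma inner_le_zero_of_isClosest {S : Set E} (hS : Convex ℝ S) {v p : E} (hp : p ∈ S)
    (hmin : ∀ w ∈ S, ‖v - p‖ ≤ ‖v - w‖) : ∀ w ∈ S, inner ℝ (v - p) (w - p) ≤ 0 := by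
  rw [← norm_eq_iInf_iff_real_inner_le_zero hS hp]
  have : Nonempty S := ⟨⟨p, hp⟩⟩
  exact le_antisymm (le_ciInf fun w => hmin w w.2)
    (ciInf_le ⟨0, by rintro _ ⟨w, rfl⟩; exact norm_nonneg _⟩ (⟨p, hp⟩ : S))

variable [CompleteSpace E]

/-- `prox` is picked by `Classical.epsilon`, so it has no properties until some minimizer is
exhibited; the nearest point of the closed convex set `S` is one. -/
lemma prox_indicatorFn_mem_argminOn {S : Set E} (hc : IsClosed S) (hS : Convex ℝ S)
    (hne : S.Nonempty) {t : ℝ} (ht : 0 < t) (v : E) :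
    prox t (indicatorFn S) v ∈ argminOn (fun w => ‖v - w‖ ^ 2 / (2 * t)) S := by
  have key : ∀ p, p ∈ argminOn (fun w => indicatorFn S w + ((‖v - w‖ ^ 2 / (2 * t) : ℝ) : EReal))
      Set.univ ↔ p ∈ argminOn (fun w => ‖v - w‖ ^ 2 / (2 * t)) S := by
    intro p
    have := mem_argminOn_composite_indicatorFn_iff (fun w => ‖v - w‖ ^ 2 / (2 * t))
      (S := S) (T := Set.univ) (by simpa using hne) p
    rw [Set.univ_inter] at this
    rw [← this]
    simp only [argminOn, composite, add_comm]
  rw [← key]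
  obtain ⟨p, hp, hpmin⟩ := exists_norm_eq_iInf_of_complete_convex hne hc.isComplete hS v
  refine Classical.epsilon_spec (p := fun p => p ∈ argminOn (fun w => indicatorFn S w +
    ((‖v - w‖ ^ 2 / (2 * t) : ℝ) : EReal)) Set.univ) ⟨p, (key p).2 ⟨hp, fun w hw => ?_⟩⟩
  have : ‖v - p‖ ≤ ‖v - w‖ := by
    rw [hpmin]
    exact ciInf_le ⟨0, by rintro _ ⟨w, rfl⟩; exact norm_nonneg _⟩ (⟨w, hw⟩ : S)
  dsimp only
  gcongr

lemma prox_indicatorFn_mem {S : Set E} (hc : IsClosed S) (hS : Convex ℝ S)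
    (hne : S.Nonempty) {t : ℝ} (ht : 0 < t) (v : E) : prox t (indicatorFn S) v ∈ S :=
  (prox_indicatorFn_mem_argminOn hc hS hne ht v).1

lemma inner_sub_prox_indicatorFn_le_zero {S : Set E} (hc : IsClosed S) (hS : Convex ℝ S)
    {t : ℝ} (ht : 0 < t) (v : E) {w : E} (hw : w ∈ S) :
    inner ℝ (v - prox t (indicatorFn S) v) (w - prox t (indicatorFn S) v) ≤ 0 := by
  obtain ⟨hp, hmin⟩ := prox_indicatorFn_mem_argminOn hc hS ⟨w, hw⟩ ht v
  refine inner_le_zero_of_isClosest hS hp (fun u hu => ?_) w hw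
  have := hmin u hu
  dsimp only at this
  rw [div_le_div_iff_of_pos_right (by positivity)] at this
  exact (sq_le_sq₀ (norm_nonneg _) (norm_nonneg _)).1 this

/-- Adding the obtuse angle inequalities at the two projections gives firm nonexpansiveness;
Cauchy-Schwarz finishes. It serves to make the prox-gradient mapping continuous. -/
lemma norm_prox_indicatorFn_sub_le {S : Set E} (hc : IsClosed S) (hS : Convex ℝ S)
    (hne : S.Nonempty) {t : ℝ} (ht : 0 < t) (u v : E) :
    ‖prox t (indicatorFn S) u - prox t (indicatorFn S) v‖ ≤ ‖u - v‖ := by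
  have h1 := inner_sub_prox_indicatorFn_le_zero hc hS ht u (prox_indicatorFn_mem hc hS hne ht v)
  have h2 := inner_sub_prox_indicatorFn_le_zero hc hS ht v (prox_indicatorFn_mem hc hS hne ht u)
  set p := prox t (indicatorFn S) u
  set q := prox t (indicatorFn S) v
  have h3 : ‖p - q‖ ^ 2 ≤ inner ℝ (u - v) (p - q) := by
    have : ‖p - q‖ ^ 2 = inner ℝ (u - v) (p - q) + inner ℝ (u - p) (q - p)
        + inner ℝ (v - q) (p - q) := by
      rw [← real_inner_self_eq_norm_sq]
      simp only [inner_sub_left, inner_sub_right]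
      ring
    linarith
  have h4 := h3.trans (real_inner_le_norm (u - v) (p - q))
  rcases (norm_nonneg (p - q)).eq_or_lt with h | h
  · rw [← h]; positivity
  · nlinarith

lemma continuous_prox_indicatorFn {S : Set E} (hc : IsClosed S) (hS : Convex ℝ S)
    (hne : S.Nonempty) {t : ℝ} (ht : 0 < t) : Continuous (prox t (indicatorFn S)) :=
  LipschitzWith.continuous (K := 1) <| LipschitzWith.of_dist_le_mul fun u v => by
    simpa [dist_eq_norm] using norm_prox_indicatorFn_sub_le hc hS hne ht u v

/-- The projection onto a centered ball leaves every linear subspace invariant. -/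
lemma prox_indicatorFn_closedBall_mem_submodule {r t : ℝ} (hr : 0 ≤ r) (ht : 0 < t)
    (V : Submodule ℝ E) [V.HasOrthogonalProjection] {v : E} (hv : v ∈ V) :
    prox t (indicatorFn (Metric.closedBall 0 r)) v ∈ V := by
  have hball := prox_indicatorFn_mem (S := Metric.closedBall (0 : E) r) Metric.isClosed_closedBall
    (convex_closedBall _ _) ⟨0, by simpa using hr⟩ ht v
  have hle := fun w => inner_sub_prox_indicatorFn_le_zero (S := Metric.closedBall (0 : E) r)
    Metric.isClosed_closedBall (convex_closedBall _ _) ht v (w := w)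
  set p := prox t (indicatorFn (Metric.closedBall (0 : E) r)) v
  -- Orthogonal projection does not increase the norm, so `q` is still in the ball and may be tested
  -- against `p`. Since `p - q` is orthogonal to `V`, which contains `v - q`, the obtuse angle
  -- inequality forces `p = q`.
  set q := V.starProjection p with hq
  have hqV : q ∈ V := V.starProjection_apply_mem p
  have h1 := hle q (by
    rw [mem_closedBall_zero_iff] at hball ⊢
    exact (V.norm_starProjection_apply_le p).trans hball)
  have h2 : inner ℝ (p - q) (v - q) = 0 :=
    Submodule.starProjection_inner_eq_zero _ _ (V.sub_mem hv hqV)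
  have h3 : ‖p - q‖ ^ 2 = inner ℝ (v - p) (q - p) + inner ℝ (p - q) (v - q) := by
    rw [← real_inner_self_eq_norm_sq]
    simp only [inner_sub_left, inner_sub_right, real_inner_comm]
    ring
  have h4 : p - q = 0 := by
    rw [← norm_eq_zero]
    nlinarith [norm_nonneg (p - q)]
  rw [sub_eq_zero.1 h4]
  exact hqV

lemma fbStep_eq_prox (f : E → ℝ) (Ψ : E → EReal) {L : ℝ} (hL : 0 < L) (x : E) :
    fbStep f Ψ L x = prox (1 / L) Ψ (x - (1 / L) • ∇ f x) := by
  have : (1 / L) * (1 / L)⁻¹ = 1 := by field_simp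
  rw [fbStep, proxGrad, smul_smul, this, one_smul, sub_sub_cancel]

lemma proxGrad_eq_smul_sub_fbStep (f : E → ℝ) (Ψ : E → EReal) {L : ℝ} (hL : 0 < L) (x : E) :
    proxGrad f Ψ (1 / L) x = L • (x - fbStep f Ψ L x) := by
  rw [fbStep_eq_prox f Ψ hL, proxGrad, one_div, inv_inv]

end Prox

/-! ### Spectral bounds, the quadratic objective and the prox-gradient inequality -/

section Quadratic

variable {n : ℕ} {A : Matrix (Fin n) (Fin n) ℝ}

lemma inner_toEuclideanLin_comm (hA : A.PosSemidef) (x w : EuclideanSpace ℝ (Fin n)) :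
    inner ℝ (A.toEuclideanLin x) w = inner ℝ x (A.toEuclideanLin w) :=
  Matrix.isSymmetric_toEuclideanLin_iff.2 hA.isHermitian x w

lemma toEuclideanLin_eigenvectorBasis (hA : A.IsHermitian) (i : Fin n) :
    A.toEuclideanLin (hA.eigenvectorBasis i) = hA.eigenvalues i • hA.eigenvectorBasis i := by
  apply WithLp.ofLp_injective
  rw [Matrix.ofLp_toLpLin]
  simpa using hA.mulVec_eigenvectorBasis i

lemma hasEigenvalue_eigenvalues (hA : A.IsHermitian) (i : Fin n) :
    Module.End.HasEigenvalue (Matrix.toLin' A) (hA.eigenvalues i) := by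
  apply Module.End.hasEigenvalue_of_hasEigenvector (x := (hA.eigenvectorBasis i).ofLp)
  rw [Module.End.hasEigenvector_iff, Module.End.mem_eigenspace_iff]
  refine ⟨by simpa using hA.mulVec_eigenvectorBasis i, fun h => ?_⟩
  have : hA.eigenvectorBasis i = 0 := WithLp.ofLp_injective _ h
  exact hA.eigenvectorBasis.orthonormal.ne_zero i this

lemma inner_eigenvectorBasis_toEuclideanLin (hA : A.PosSemidef) (i : Fin n)
    (x : EuclideanSpace ℝ (Fin n)) :
    inner ℝ (hA.isHermitian.eigenvectorBasis i) (A.toEuclideanLin x) =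
      hA.isHermitian.eigenvalues i * inner ℝ (hA.isHermitian.eigenvectorBasis i) x := by
  rw [← inner_toEuclideanLin_comm hA, toEuclideanLin_eigenvectorBasis, real_inner_smul_left]

lemma inner_toEuclideanLin_eq_sum (hA : A.PosSemidef) (x : EuclideanSpace ℝ (Fin n)) :
    inner ℝ x (A.toEuclideanLin x) = ∑ i, hA.isHermitian.eigenvalues i *
      ‖(inner ℝ (hA.isHermitian.eigenvectorBasis i) x : ℝ)‖ ^ 2 := by
  rw [← hA.isHermitian.eigenvectorBasis.sum_inner_mul_inner]
  refine Finset.sum_congr rfl fun i _ => ?_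
  rw [inner_eigenvectorBasis_toEuclideanLin hA, real_inner_comm, Real.norm_eq_abs, sq_abs]
  ring

lemma le_inner_toEuclideanLin (hA : A.PosSemidef) {α : ℝ}
    (hα : α ∈ lowerBounds {μ : ℝ | Module.End.HasEigenvalue (Matrix.toLin' A) μ})
    (x : EuclideanSpace ℝ (Fin n)) : α * ‖x‖ ^ 2 ≤ inner ℝ x (A.toEuclideanLin x) := by
  rw [inner_toEuclideanLin_eq_sum hA,
    ← hA.isHermitian.eigenvectorBasis.sum_sq_norm_inner_right x, Finset.mul_sum]
  gcongr with i
  exact hα (hasEigenvalue_eigenvalues hA.isHermitian i)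

lemma inner_toEuclideanLin_le (hA : A.PosSemidef) {L : ℝ}
    (hL : L ∈ upperBounds {μ : ℝ | Module.End.HasEigenvalue (Matrix.toLin' A) μ})
    (x : EuclideanSpace ℝ (Fin n)) : inner ℝ x (A.toEuclideanLin x) ≤ L * ‖x‖ ^ 2 := by
  rw [inner_toEuclideanLin_eq_sum hA,
    ← hA.isHermitian.eigenvectorBasis.sum_sq_norm_inner_right x, Finset.mul_sum]
  gcongr with i
  exact hL (hasEigenvalue_eigenvalues hA.isHermitian i)

lemma inner_toEuclideanLin_nonneg (hA : A.PosSemidef) (x : EuclideanSpace ℝ (Fin n)) :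
    0 ≤ inner ℝ x (A.toEuclideanLin x) := by
  rw [inner_toEuclideanLin_eq_sum hA]
  exact Finset.sum_nonneg fun i _ => mul_nonneg (hA.eigenvalues_nonneg i) (by positivity)

/-- In the eigenbasis; nonnegativity of the eigenvalues turns `λ ≤ L` into `λ² ≤ L²`. -/
lemma norm_toEuclideanLin_le (hA : A.PosSemidef) {L : ℝ} (hL0 : 0 ≤ L)
    (hL : L ∈ upperBounds {μ : ℝ | Module.End.HasEigenvalue (Matrix.toLin' A) μ})
    (x : EuclideanSpace ℝ (Fin n)) : ‖A.toEuclideanLin x‖ ≤ L * ‖x‖ := by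
  rw [← sq_le_sq₀ (norm_nonneg _) (by positivity), mul_pow,
    ← hA.isHermitian.eigenvectorBasis.sum_sq_norm_inner_right x,
    ← hA.isHermitian.eigenvectorBasis.sum_sq_norm_inner_right (A.toEuclideanLin x),
    Finset.mul_sum]
  refine Finset.sum_le_sum fun i _ => ?_
  rw [inner_eigenvectorBasis_toEuclideanLin hA, norm_mul, mul_pow, Real.norm_eq_abs, sq_abs]
  have := hL (hasEigenvalue_eigenvalues hA.isHermitian i)
  have := hA.eigenvalues_nonneg i
  gcongr

/-- A vanishing sum of nonnegative terms: for each eigenvector, the eigenvalue or the coordinate is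
zero. This settles the case of a zero denominator in the step length. -/
lemma toEuclideanLin_eq_zero_of_inner_eq_zero (hA : A.PosSemidef) {x : EuclideanSpace ℝ (Fin n)}
    (hx : inner ℝ x (A.toEuclideanLin x) = 0) : A.toEuclideanLin x = 0 := by
  rw [inner_toEuclideanLin_eq_sum hA, Finset.sum_eq_zero_iff_of_nonneg
    fun i _ => mul_nonneg (hA.eigenvalues_nonneg i) (by positivity)] at hx
  rw [← norm_eq_zero, ← sq_eq_zero_iff,
    ← hA.isHermitian.eigenvectorBasis.sum_sq_norm_inner_right (A.toEuclideanLin x)]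
  refine Finset.sum_eq_zero fun i hi => ?_
  rw [inner_eigenvectorBasis_toEuclideanLin hA]
  rcases mul_eq_zero.1 (hx i hi) with h | h
  · simp [h]
  · rw [norm_mul, mul_pow, h, mul_zero]

variable (b : EuclideanSpace ℝ (Fin n))

/-- The second-order expansion of the quadratic function `f`. -/
lemma quad_eq_add (hA : A.PosSemidef) (x w : EuclideanSpace ℝ (Fin n)) :
    quad A b w = quad A b x + inner ℝ (A.toEuclideanLin x - b) (w - x) +
      1 / 2 * inner ℝ (w - x) (A.toEuclideanLin (w - x)) := by
  have h := inner_toEuclideanLin_comm hA x w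
  have h' := inner_toEuclideanLin_comm hA x x
  simp only [quad, map_sub, inner_sub_left, inner_sub_right, h, h',
    real_inner_comm (A.toEuclideanLin x) w]
  ring

lemma hasGradientAt_quad (hA : A.PosSemidef) (x : EuclideanSpace ℝ (Fin n)) :
    HasGradientAt (quad A b) (A.toEuclideanLin x - b) x := by
  set T : EuclideanSpace ℝ (Fin n) →L[ℝ] EuclideanSpace ℝ (Fin n) :=
    LinearMap.toContinuousLinearMap A.toEuclideanLin with hT
  have hq : quad A b = fun w => 1 / 2 * inner ℝ w (T w) - inner ℝ b w := rfl
  rw [hasGradientAt_iff_hasFDerivAt, hq]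
  have h1 := (((hasFDerivAt_id x).inner ℝ (T.hasFDerivAt (x := x))).const_mul (1 / 2)).sub
    ((innerSL ℝ b).hasFDerivAt (x := x))
  refine h1.congr_fderiv ?_
  ext v
  have h := inner_toEuclideanLin_comm hA x v
  simp [hT, h, real_inner_comm (A.toEuclideanLin x) v]
  ring

lemma gradient_quad (hA : A.PosSemidef) (x : EuclideanSpace ℝ (Fin n)) :
    ∇ (quad A b) x = A.toEuclideanLin x - b :=
  (hasGradientAt_quad b hA x).gradient

lemma strongConvexOn_quad (hA : A.PosSemidef) {α : ℝ}
    (hα : ∀ x, α * ‖x‖ ^ 2 ≤ inner ℝ x (A.toEuclideanLin x)) :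
    StrongConvexOn Set.univ α (quad A b) := by
  refine ⟨convex_univ, fun x _ w _ s t hs ht hst => ?_⟩
  -- Both endpoint values are expanded about `c`. The linear terms cancel in the weighted sum, and
  -- the quadratic ones add up to `s t / 2` times the quadratic form at `x - w`.
  set c := s • x + t • w with hc
  have hxc : x - c = t • (x - w) := by
    rw [hc, show s = 1 - t by linarith]; module
  have hwc : w - c = (-s) • (x - w) := by
    rw [hc, show t = 1 - s by linarith]; module
  have h1 := quad_eq_add b hA c x
  have h2 := quad_eq_add b hA c w
  rw [hxc] at h1
  rw [hwc] at h2
  simp only [map_smul, inner_smul_left, inner_smul_right, RCLike.conj_to_real] at h1 h2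
  have h3 := hα (x - w)
  have h4 : 0 ≤ s * t := by positivity
  simp only [smul_eq_mul]
  rw [h1, h2]
  have h5 := mul_le_mul_of_nonneg_left h3 h4
  rw [show s = 1 - t by linarith] at h5 ⊢
  nlinarith

lemma isClosed_feasible (n : ℕ) (Δ : ℝ) : IsClosed (feasible n Δ) := Metric.isClosed_closedBall

lemma convex_feasible (n : ℕ) (Δ : ℝ) : Convex ℝ (feasible n Δ) := convex_closedBall _ _

lemma mem_feasible {Δ : ℝ} {x : EuclideanSpace ℝ (Fin n)} : x ∈ feasible n Δ ↔ ‖x‖ ≤ Δ :=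
  mem_closedBall_zero_iff

lemma zero_mem_feasible (n : ℕ) {Δ : ℝ} (hΔ : 0 < Δ) : 0 ∈ feasible n Δ := by
  simpa [mem_feasible] using hΔ.le

variable {Δ L : ℝ}

lemma fbStep_mem_feasible (hΔ : 0 < Δ) (hL : 0 < L) (z : EuclideanSpace ℝ (Fin n)) :
    fbStep (quad A b) (indicatorFn (feasible n Δ)) L z ∈ feasible n Δ := by
  rw [fbStep_eq_prox _ _ hL]
  exact prox_indicatorFn_mem (isClosed_feasible n Δ) (convex_feasible n Δ)
    ⟨0, zero_mem_feasible n hΔ⟩ (by positivity) _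

lemma continuous_proxGrad_quad (hA : A.PosSemidef) (hΔ : 0 < Δ) (hL : 0 < L) :
    Continuous (proxGrad (quad A b) (indicatorFn (feasible n Δ)) (1 / L)) := by
  have h := continuous_prox_indicatorFn (isClosed_feasible n Δ) (convex_feasible n Δ)
    ⟨0, zero_mem_feasible n hΔ⟩ (one_div_pos.2 hL)
  have h' : Continuous A.toEuclideanLin := LinearMap.continuous_of_finiteDimensional _
  simp only [funext (proxGrad_eq_smul_sub_fbStep (quad A b) _ hL), fbStep_eq_prox _ _ hL,
    gradient_quad b hA]
  fun_prop

/-- The prox-gradient inequality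
`f(w) ≥ f(z̄) + G(z)ᵀ(w - z) + ‖G(z)‖² / (2L) + α ‖w - z‖² / 2` for feasible `w`. -/
lemma proxGrad_inequality (hA : A.PosSemidef) (hL : 0 < L) {α : ℝ}
    (hα : ∀ x, α * ‖x‖ ^ 2 ≤ inner ℝ x (A.toEuclideanLin x))
    (hLu : ∀ x, inner ℝ x (A.toEuclideanLin x) ≤ L * ‖x‖ ^ 2)
    (z : EuclideanSpace ℝ (Fin n)) {w : EuclideanSpace ℝ (Fin n)} (hw : w ∈ feasible n Δ) :
    quad A b (fbStep (quad A b) (indicatorFn (feasible n Δ)) L z) +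
      inner ℝ (proxGrad (quad A b) (indicatorFn (feasible n Δ)) (1 / L) z) (w - z) +
      1 / (2 * L) * ‖proxGrad (quad A b) (indicatorFn (feasible n Δ)) (1 / L) z‖ ^ 2 +
      α / 2 * ‖w - z‖ ^ 2 ≤ quad A b w := by
  have hobt := inner_sub_prox_indicatorFn_le_zero (isClosed_feasible n Δ) (convex_feasible n Δ)
    (one_div_pos.2 hL) (z - (1 / L) • ∇ (quad A b) z) hw
  rw [proxGrad_eq_smul_sub_fbStep _ _ hL]
  rw [← fbStep_eq_prox _ _ hL, gradient_quad b hA] at hobt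
  set q := fbStep (quad A b) (indicatorFn (feasible n Δ)) L z
  set g := A.toEuclideanLin z - b with hg
  -- Expanding at `z` bounds `f(w)` below with curvature `α` and `f(q)` above with curvature `L`.
  -- The difference of the two linear terms is controlled by the obtuse angle inequality at `q`,
  -- whose `L ‖q - z‖²` pays for the upper bound and leaves `L ‖q - z‖² / 2 = ‖G‖² / (2L)`.
  have h1 := quad_eq_add b hA z w
  have h2 := quad_eq_add b hA z q
  have h3 := hα (w - z)
  have h4 := hLu (q - z)
  have hnorm : ‖L • (z - q)‖ ^ 2 = L ^ 2 * ‖q - z‖ ^ 2 := by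
    rw [norm_smul, mul_pow, norm_sub_rev z q, Real.norm_eq_abs, sq_abs]
  have h5 : L * inner ℝ (z - (1 / L) • g - q) (w - q) ≤ 0 :=
    mul_nonpos_of_nonneg_of_nonpos hL.le hobt
  have h6 : L * inner ℝ (z - (1 / L) • g - q) (w - q) =
      L * inner ℝ (z - q) (w - z) + L * ‖q - z‖ ^ 2 - (inner ℝ g (w - z) - inner ℝ g (q - z)) := by
    have e1 : z - (1 / L) • g - q = (z - q) - (1 / L) • g := by abel
    have e2 : w - q = (w - z) + (z - q) := by abel
    have e3 : q - z = -(z - q) := by abel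
    rw [e1, e2, e3, inner_sub_left, inner_add_right, real_inner_smul_left, inner_add_right,
      real_inner_self_eq_norm_sq, norm_neg, inner_neg_right]
    field_simp
    ring
  rw [hnorm, real_inner_smul_left]
  have h7 : 1 / (2 * L) * (L ^ 2 * ‖q - z‖ ^ 2) = L / 2 * ‖q - z‖ ^ 2 := by field_simp
  rw [h7]
  linarith

end Quadratic

/-! ### Invariance properties of the Krylov subspaces -/

section Krylov

variable {n : ℕ} {A : Matrix (Fin n) (Fin n) ℝ} {b : EuclideanSpace ℝ (Fin n)}

lemma krylov_mono : Monotone (krylov A b) := fun _ _ h =>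
  Submodule.span_mono (Set.image_mono fun _ hi => lt_of_lt_of_le hi h)

lemma cgDir_mem_krylov {j k : ℕ} (h : j < k) : cgDir A b j ∈ krylov A b k :=
  Submodule.subset_span ⟨j, h, rfl⟩

lemma krylov_zero : krylov A b 0 = ⊥ := by
  simp [krylov]

lemma right_mem_krylov {k : ℕ} (hk : 1 ≤ k) : b ∈ krylov A b k :=
  cgDir_mem_krylov (A := A) (b := b) (j := 0) hk

lemma cgDir_succ (k : ℕ) : cgDir A b (k + 1) =
    (inner ℝ (cgState A b (k + 1)).1 (cgState A b (k + 1)).1 /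
      inner ℝ (cgState A b k).1 (cgState A b k).1 : ℝ) • cgDir A b k +
      (cgState A b (k + 1)).1 := rfl

lemma cgState_succ_fst (k : ℕ) : (cgState A b (k + 1)).1 = (cgState A b k).1 -
    cgStep A (cgState A b k).1 (cgDir A b k) • A.toEuclideanLin (cgDir A b k) := rfl

lemma cgState_fst_mem_krylov (k : ℕ) : (cgState A b k).1 ∈ krylov A b (k + 1) := by
  cases k with
  | zero => exact right_mem_krylov le_rfl
  | succ k =>
    rw [← sub_eq_of_eq_add' (cgDir_succ k)]
    exact Submodule.sub_mem _ (cgDir_mem_krylov (by lia))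
      (Submodule.smul_mem _ _ (cgDir_mem_krylov (by lia)))

lemma cgDir_eq_zero_of_fst_eq_zero {k : ℕ} (h : (cgState A b k).1 = 0) : cgDir A b k = 0 := by
  cases k with
  | zero => exact h
  | succ k => rw [cgDir_succ, h]; simp

/-- The residual recursion reads `α_k A p_k = r_k - r_{k+1}`, so `A p_k` is recovered by division
unless `α_k = 0`. In that case either `p_kᵀ A p_k = 0`, hence `A p_k = 0`, or `r_k = 0`, hence `p_k
= 0`. -/
lemma toEuclideanLin_cgDir_mem_krylov (hA : A.PosSemidef) (k : ℕ) :
    A.toEuclideanLin (cgDir A b k) ∈ krylov A b (k + 2) := by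
  by_cases hp : inner ℝ (cgDir A b k) (A.toEuclideanLin (cgDir A b k)) = (0 : ℝ)
  · rw [toEuclideanLin_eq_zero_of_inner_eq_zero hA hp]
    exact Submodule.zero_mem _
  by_cases hr : (cgState A b k).1 = 0
  · rw [cgDir_eq_zero_of_fst_eq_zero hr, map_zero]
    exact Submodule.zero_mem _
  have hstep : cgStep A (cgState A b k).1 (cgDir A b k) ≠ 0 :=
    div_ne_zero (inner_self_ne_zero.2 hr) hp
  have hsub : cgStep A (cgState A b k).1 (cgDir A b k) • A.toEuclideanLin (cgDir A b k) =
      (cgState A b k).1 - (cgState A b (k + 1)).1 := by rw [cgState_succ_fst, sub_sub_cancel]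
  rw [← Submodule.smul_mem_iff _ hstep, hsub]
  exact Submodule.sub_mem _ (krylov_mono (by lia) (cgState_fst_mem_krylov k))
    (cgState_fst_mem_krylov (k + 1))

/-- `A V_k ⊆ V_{k+1}`. -/
lemma toEuclideanLin_mem_krylov (hA : A.PosSemidef) {k : ℕ} {v : EuclideanSpace ℝ (Fin n)}
    (hv : v ∈ krylov A b k) : A.toEuclideanLin v ∈ krylov A b (k + 1) := by
  have : krylov A b k ≤ (krylov A b (k + 1)).comap A.toEuclideanLin := by
    rw [krylov, Submodule.span_le]
    rintro _ ⟨j, hj, rfl⟩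
    have hj' : j + 2 ≤ k + 1 := Nat.succ_le_succ hj
    exact krylov_mono hj' (toEuclideanLin_cgDir_mem_krylov hA j)
  exact this hv

variable {Δ L : ℝ}

/-- The gradient step lands in `V_{k+1}` because `A v` and `b` do, and projecting onto the centered
ball does not leave that subspace. -/
lemma fbStep_mem_krylov (hA : A.PosSemidef) (hΔ : 0 < Δ) (hL : 0 < L) {k : ℕ}
    {v : EuclideanSpace ℝ (Fin n)} (hv : v ∈ krylov A b k) :
    fbStep (quad A b) (indicatorFn (feasible n Δ)) L v ∈ krylov A b (k + 1) := by
  rw [fbStep_eq_prox _ _ hL, gradient_quad b hA]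
  refine prox_indicatorFn_closedBall_mem_submodule hΔ.le (one_div_pos.2 hL) _ ?_
  exact Submodule.sub_mem _ (krylov_mono k.le_succ hv) (Submodule.smul_mem _ _
    (Submodule.sub_mem _ (toEuclideanLin_mem_krylov hA hv) (right_mem_krylov (by lia))))

lemma proxGrad_mem_krylov (hA : A.PosSemidef) (hΔ : 0 < Δ) (hL : 0 < L) {k : ℕ}
    {v : EuclideanSpace ℝ (Fin n)} (hv : v ∈ krylov A b k) :
    proxGrad (quad A b) (indicatorFn (feasible n Δ)) (1 / L) v ∈ krylov A b (k + 1) := by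
  rw [proxGrad_eq_smul_sub_fbStep _ _ hL]
  exact Submodule.smul_mem _ _
    (Submodule.sub_mem _ (krylov_mono k.le_succ hv) (fbStep_mem_krylov hA hΔ hL hv))

end Krylov

/-! ### Affine hulls inside a linear subspace -/

section Affine

variable {E : Type*} [AddCommGroup E] [Module ℝ E]

lemma mk'_span_le_toAffineSubspace {V : Submodule ℝ E} {v : E} (hv : v ∈ V) {s : Set E}
    (hs : s ⊆ V) : AffineSubspace.mk' v (Submodule.span ℝ s) ≤ V.toAffineSubspace := by
  intro w hw
  rw [AffineSubspace.mem_mk', vsub_eq_sub] at hw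
  rw [Submodule.mem_toAffineSubspace, ← sub_add_cancel w v]
  exact V.add_mem (Submodule.span_le.2 hs hw) hv

end Affine

/-! ### Existence of the auxiliary points -/

section Existence

variable {E : Type*} [NormedAddCommGroup E] [InnerProductSpace ℝ E]

/-- The segment from `x` to `y` contains a point `z` at which a continuous vector field `G` points
away neither from `x` nor from `y`. -/
lemma exists_segment_inner_nonneg {G : E → E} (hG : Continuous G) (x y : E) :
    ∃ z ∈ segment ℝ x y, 0 ≤ inner ℝ (G z) (y - z) ∧ 0 ≤ inner ℝ (G z) (x - z) := by
  by_cases h0 : 0 ≤ inner ℝ (G x) (y - x)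
  · exact ⟨x, left_mem_segment ℝ x y, h0, by simp⟩
  by_cases h1 : inner ℝ (G y) (y - x) ≤ 0
  · refine ⟨y, right_mem_segment ℝ x y, by simp, ?_⟩
    rw [← neg_sub y x, inner_neg_right]
    linarith
  push Not at h0 h1
  -- Neither endpoint works, so the component of `G` along `y - x` is negative at `x` and positive
  -- at `y`. At an interior zero both inner products vanish.
  have hc : Continuous fun t : ℝ => inner ℝ (G (x + t • (y - x))) (y - x) := by fun_prop
  obtain ⟨t, ht, hzero⟩ := intermediate_value_Icc zero_le_one hc.continuousOn
    (show (0 : ℝ) ∈ Set.Icc _ _ by simpa using ⟨h0.le, h1.le⟩)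
  dsimp only at hzero
  refine ⟨x + t • (y - x), ?_, ?_, ?_⟩
  · rw [segment_eq_image']
    exact ⟨t, ht, rfl⟩
  · rw [show y - (x + t • (y - x)) = (1 - t) • (y - x) by module, inner_smul_right, hzero, mul_zero]
  · rw [show x - (x + t • (y - x)) = (-t) • (y - x) by module, inner_smul_right, hzero, mul_zero]

lemma starProjection_mem_argminOn (V : Submodule ℝ E) [V.HasOrthogonalProjection] (u : E) :
    V.starProjection u ∈ argminOn (fun w => ‖w - u‖ ^ 2) (V : Set E) := by
  refine ⟨V.starProjection_apply_mem u, fun w hw => ?_⟩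
  have h := Submodule.starProjection_inner_eq_zero u _ (V.sub_mem (V.starProjection_apply_mem u) hw)
  have h2 : ‖w - u‖ ^ 2 = ‖V.starProjection u - u‖ ^ 2 + ‖V.starProjection u - w‖ ^ 2 +
      2 * inner ℝ (u - V.starProjection u) (V.starProjection u - w) := by
    simp only [← real_inner_self_eq_norm_sq, inner_sub_left, inner_sub_right]
    simp only [real_inner_comm]
    ring
  dsimp only
  rw [h2, h]
  nlinarith [sq_nonneg ‖V.starProjection u - w‖]

end Existence

/-! ### Potential arguments, fit to the framework and convergence rates -/

section Rates

variable {n : ℕ} {A : Matrix (Fin n) (Fin n) ℝ} {b : EuclideanSpace ℝ (Fin n)} {Δ L : ℝ}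

lemma isCompositeProblem_quad (hA : A.PosSemidef) (hΔ : 0 < Δ) {α : ℝ} (hL0 : 0 < L)
    (hα : α ∈ lowerBounds {μ : ℝ | Module.End.HasEigenvalue (Matrix.toLin' A) μ})
    (hL : L ∈ upperBounds {μ : ℝ | Module.End.HasEigenvalue (Matrix.toLin' A) μ})
    {xs : EuclideanSpace ℝ (Fin n)} (hxs : xs ∈ argminOn (objective A b Δ) Set.univ) :
    IsCompositeProblem (quad A b) (indicatorFn (feasible n Δ)) α L xs := by
  have hepi : {p : EuclideanSpace ℝ (Fin n) × ℝ | indicatorFn (feasible n Δ) p.1 ≤ (p.2 : EReal)} =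
      feasible n Δ ×ˢ Set.Ici 0 := by
    ext p
    by_cases hp : p.1 ∈ feasible n Δ
    · simp [indicatorFn_of_mem hp, hp]
    · simp [indicatorFn_of_notMem hp, hp]
  refine ⟨hL0, fun x => (hasGradientAt_quad b hA x).differentiableAt, fun x w => ?_,
    strongConvexOn_quad b hA (le_inner_toEuclideanLin hA hα), ?_, fun x => ?_,
    ⟨0, by simp [indicatorFn_of_mem (zero_mem_feasible n hΔ)]⟩, ?_, hxs⟩
  · rw [gradient_quad b hA, gradient_quad b hA, sub_sub_sub_cancel_right, ← map_sub]
    exact norm_toEuclideanLin_le hA hL0.le hL _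
  · rw [hepi]
    exact (isClosed_feasible n Δ).prod isClosed_Ici
  · by_cases hp : x ∈ feasible n Δ
    · simp [indicatorFn_of_mem hp]
    · simp [indicatorFn_of_notMem hp]
  · rw [hepi]
    exact (convex_feasible n Δ).prod (convex_Ici 0)

/-- The existence of a vector `z_k` as in the analysis of the method. -/
lemma exists_auxiliary_point (hA : A.PosSemidef) (hΔ : 0 < Δ) (hL : 0 < L)
    (hLu : ∀ x, inner ℝ x (A.toEuclideanLin x) ≤ L * ‖x‖ ^ 2) {V : Submodule ℝ _}
    {x y : EuclideanSpace ℝ (Fin n)} (hx : x ∈ V) (hxΔ : x ∈ feasible n Δ) (hy : y ∈ V) :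
    ∃ z ∈ V, 0 ≤ inner ℝ (proxGrad (quad A b) (indicatorFn (feasible n Δ)) (1 / L) z) (y - z) ∧
      0 ≤ inner ℝ (proxGrad (quad A b) (indicatorFn (feasible n Δ)) (1 / L) z) (x - z) ∧
      quad A b (fbStep (quad A b) (indicatorFn (feasible n Δ)) L z) ≤ quad A b x -
        1 / (2 * L) * ‖proxGrad (quad A b) (indicatorFn (feasible n Δ)) (1 / L) z‖ ^ 2 := by
  obtain ⟨z, hz, hzy, hzx⟩ :=
    exists_segment_inner_nonneg (continuous_proxGrad_quad b hA hΔ hL) x y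
  refine ⟨z, V.convex.segment_subset hx hy hz, hzy, hzx, ?_⟩
  -- Tested at `w = x`, where the inner product term is nonnegative and can be dropped.
  have := proxGrad_inequality b hA hL (α := 0)
    (fun x => by simpa using inner_toEuclideanLin_nonneg hA x) hLu z hxΔ
  linarith

/-- One step of the method contracts the potential `‖y_k - x*‖² + 2 (F(x_k) - F(x*)) / α`. -/
lemma linear_rate_step (hA : A.PosSemidef) (hΔ : 0 < Δ) {α : ℝ} (hα0 : 0 < α) (hαL : α ≤ L)
    (hα : ∀ x, α * ‖x‖ ^ 2 ≤ inner ℝ x (A.toEuclideanLin x))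
    (hLu : ∀ x, inner ℝ x (A.toEuclideanLin x) ≤ L * ‖x‖ ^ 2)
    {xs x x' y y' : EuclideanSpace ℝ (Fin n)} (hxs : xs ∈ feasible n Δ) {k : ℕ}
    (hx : x ∈ krylov A b k) (hxΔ : x ∈ feasible n Δ)
    (hx' : x' ∈ argminOn (quad A b) {w | w ∈ krylov A b (k + 1) ∧ ‖w‖ ≤ Δ})
    (hy : y ∈ krylov A b k)
    (hy' : y' ∈ argminOn (fun w => ‖w - xs‖ ^ 2) (krylov A b (k + 1) : Set _)) :
    ‖y' - xs‖ ^ 2 + 2 * (quad A b x' - quad A b xs) / α ≤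
      (1 - √(α / L)) * (‖y - xs‖ ^ 2 + 2 * (quad A b x - quad A b xs) / α) := by
  have hL : 0 < L := hα0.trans_le hαL
  obtain ⟨z, hz, hzy, -, hzd⟩ := exists_auxiliary_point (b := b) hA hΔ hL hLu hx hxΔ hy
  have hineq := proxGrad_inequality b hA hL hα hLu z hxs
  have hGV := proxGrad_mem_krylov hA hΔ hL hz
  have hx'z := hx'.2 _ ⟨fbStep_mem_krylov hA hΔ hL hz,
    mem_feasible.1 (fbStep_mem_feasible b hΔ hL z)⟩
  set G := proxGrad (quad A b) (indicatorFn (feasible n Δ)) (1 / L) z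
  set zb := fbStep (quad A b) (indicatorFn (feasible n Δ)) L z
  set q := √(α / L) with hq
  have hq0 : 0 ≤ q := Real.sqrt_nonneg _
  have hq2 : q ^ 2 = α / L := Real.sq_sqrt (by positivity)
  have hq1 : q ≤ 1 := by
    rw [hq, Real.sqrt_le_one]
    exact (div_le_one hL).2 hαL
  have hkk := krylov_mono (A := A) (b := b) k.le_succ
  -- The competitor for `y'` is the accelerated gradient update: a convex combination of `y` and the
  -- long step `z - G / α`, with weight `q = √(α / L)`.
  have hy'w := hy'.2 ((1 - q) • y + q • (z - α⁻¹ • G)) (Submodule.add_mem _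
    (Submodule.smul_mem _ _ (hkk hy)) (Submodule.smul_mem _ _
      (Submodule.sub_mem _ (hkk hz) (Submodule.smul_mem _ _ hGV))))
  dsimp only at hy'w
  have hcomb : ‖(1 - q) • y + q • (z - α⁻¹ • G) - xs‖ ^ 2 = (1 - q) * ‖y - xs‖ ^ 2 +
      q * ‖z - α⁻¹ • G - xs‖ ^ 2 - q * (1 - q) * ‖y - z + α⁻¹ • G‖ ^ 2 := by
    have e1 : (1 - q) • y + q • (z - α⁻¹ • G) - xs =
      (1 - q) • (y - xs) + q • (z - α⁻¹ • G - xs) := by module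
    have e2 : y - z + α⁻¹ • G = (y - xs) - (z - α⁻¹ • G - xs) := by abel
    rw [e1, e2]
    generalize y - xs = u
    generalize z - α⁻¹ • G - xs = v
    rw [norm_add_sq_real, norm_sub_sq_real, norm_smul, norm_smul, mul_pow, mul_pow,
      Real.norm_eq_abs, Real.norm_eq_abs, sq_abs, sq_abs, inner_smul_left, inner_smul_right]
    simp only [RCLike.conj_to_real]
    ring
  have hN : ∀ v : EuclideanSpace ℝ (Fin n), ‖v + α⁻¹ • G‖ ^ 2 =
      ‖v‖ ^ 2 + 2 / α * inner ℝ G v + ‖G‖ ^ 2 / α ^ 2 := by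
    intro v
    rw [norm_add_sq_real, norm_smul, mul_pow, Real.norm_eq_abs, sq_abs, real_inner_smul_right,
      real_inner_comm]
    field_simp
  have hyz : ‖G‖ ^ 2 / α ^ 2 ≤ ‖y - z + α⁻¹ • G‖ ^ 2 := by
    rw [hN]
    have : 0 ≤ 2 / α * inner ℝ G (y - z) := by positivity
    linarith [sq_nonneg ‖y - z‖]
  have hzxs : ‖z - α⁻¹ • G - xs‖ ^ 2 ≤ (1 - q ^ 2) * (‖G‖ ^ 2 / α ^ 2) -
      2 / α * (quad A b zb - quad A b xs) := by
    rw [show z - α⁻¹ • G - xs = -((xs - z) + α⁻¹ • G) by abel, norm_neg, hN, hq2]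
    have h := mul_le_mul_of_nonneg_left hineq (show 0 ≤ 2 / α by positivity)
    have e1 : 2 / α * (quad A b zb + inner ℝ G (xs - z) + 1 / (2 * L) * ‖G‖ ^ 2 +
        α / 2 * ‖xs - z‖ ^ 2) = 2 / α * quad A b zb + 2 / α * inner ℝ G (xs - z) +
        α / L * (‖G‖ ^ 2 / α ^ 2) + ‖xs - z‖ ^ 2 := by
      field_simp
    rw [e1] at h
    linarith
  have hd : 2 / α * (quad A b zb - quad A b xs) ≤ 2 / α * (quad A b x - quad A b xs) -
      q ^ 2 * (‖G‖ ^ 2 / α ^ 2) := by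
    have h := mul_le_mul_of_nonneg_left hzd (show 0 ≤ 2 / α by positivity)
    have e1 : q ^ 2 * (‖G‖ ^ 2 / α ^ 2) = 2 / α * (1 / (2 * L) * ‖G‖ ^ 2) := by
      rw [hq2]; field_simp
    rw [e1]
    linarith
  have hd' : 2 / α * (quad A b x' - quad A b xs) ≤ 2 / α * (quad A b zb - quad A b xs) := by
    gcongr
  rw [mul_div_right_comm, mul_div_right_comm 2 (quad A b x - _)]
  -- With these weights the coefficient of `‖G‖² / α²` is `q (1 - q²) - q (1 - q) - (1 - q) q² = 0`,
  -- and the term in `f(z̄)` with weight `q` cancels as well; this fixes the choice of `q`.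
  have h1 := mul_le_mul_of_nonneg_left hyz (mul_nonneg hq0 (sub_nonneg.2 hq1))
  have h2 := mul_le_mul_of_nonneg_left hzxs hq0
  have h3 := mul_le_mul_of_nonneg_left hd (sub_nonneg.2 hq1)
  linarith

/-- The potential `k (k + 1) (F(x_k) - F(x*)) / 4 + L ‖y_k - x*‖² / 2` does not increase. -/
lemma sublinear_rate_step (hA : A.PosSemidef) (hΔ : 0 < Δ) (hL : 0 < L)
    (hLu : ∀ x, inner ℝ x (A.toEuclideanLin x) ≤ L * ‖x‖ ^ 2)
    {xs x x' y y' : EuclideanSpace ℝ (Fin n)} (hxs : xs ∈ feasible n Δ) {k : ℕ}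
    (hx : x ∈ krylov A b k) (hxΔ : x ∈ feasible n Δ)
    (hx' : x' ∈ argminOn (quad A b) {w | w ∈ krylov A b (k + 1) ∧ ‖w‖ ≤ Δ})
    (hy : y ∈ krylov A b k)
    (hy' : y' ∈ argminOn (fun w => ‖w - xs‖ ^ 2) (krylov A b (k + 1) : Set _)) :
    (k + 1 : ℝ) * (k + 2) / 4 * (quad A b x' - quad A b xs) + L / 2 * ‖y' - xs‖ ^ 2 ≤
      (k : ℝ) * (k + 1) / 4 * (quad A b x - quad A b xs) + L / 2 * ‖y - xs‖ ^ 2 := by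
  obtain ⟨z, hz, hzy, -, hzd⟩ := exists_auxiliary_point (b := b) hA hΔ hL hLu hx hxΔ hy
  have hineq := proxGrad_inequality b hA hL (α := 0)
    (fun x => by simpa using inner_toEuclideanLin_nonneg hA x) hLu z hxs
  have hGV := proxGrad_mem_krylov hA hΔ hL hz
  have hx'z := hx'.2 _ ⟨fbStep_mem_krylov hA hΔ hL hz,
    mem_feasible.1 (fbStep_mem_feasible b hΔ hL z)⟩
  set G := proxGrad (quad A b) (indicatorFn (feasible n Δ)) (1 / L) z
  set zb := fbStep (quad A b) (indicatorFn (feasible n Δ)) L z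
  -- Chosen so that `(L / 2) · 2η = (k + 1) / 2`, the amount by which the weight `k (k + 1) / 4`
  -- grows. The terms in `Gᵀ(x* - z)` then cancel, and the `‖G‖²` terms leave the surplus `h8 / 4`.
  set η : ℝ := (k + 1) / (2 * L) with hη
  have hy'w := hy'.2 (y - η • G) (Submodule.sub_mem _
    (krylov_mono k.le_succ hy) (Submodule.smul_mem _ _ hGV))
  dsimp only at hy'w
  have hN : ‖y - η • G - xs‖ ^ 2 = ‖y - xs‖ ^ 2 - 2 * η * inner ℝ G (y - z) +
      2 * η * inner ℝ G (xs - z) + η ^ 2 * ‖G‖ ^ 2 := by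
    have e1 : y - η • G - xs = (y - xs) - η • G := by abel
    have e2 : y - xs = (y - z) - (xs - z) := by abel
    rw [e1, norm_sub_sq_real, norm_smul, mul_pow, Real.norm_eq_abs, sq_abs, real_inner_smul_right,
      real_inner_comm]
    nth_rewrite 2 [e2]
    rw [inner_sub_right]
    ring
  rw [hN] at hy'w
  have h1 : L / 2 * (2 * η) = (k + 1) / 2 := by rw [hη]; field_simp
  have h2 : L / 2 * η ^ 2 = (k + 1) ^ 2 / 4 * (1 / (2 * L)) := by rw [hη]; field_simp; norm_num
  have h3 := mul_le_mul_of_nonneg_left hy'w (show 0 ≤ L / 2 by positivity)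
  have h4 : 0 ≤ (k + 1 : ℝ) / 2 * inner ℝ G (y - z) := by positivity
  have h5 := mul_le_mul_of_nonneg_left hineq (show 0 ≤ (k + 1 : ℝ) / 2 by positivity)
  have h6 := mul_le_mul_of_nonneg_left hzd (show 0 ≤ (k : ℝ) * (k + 1) / 4 by positivity)
  have h7 := mul_le_mul_of_nonneg_left hx'z (show 0 ≤ (k + 1 : ℝ) * (k + 2) / 4 by positivity)
  have h8 : 0 ≤ (k + 1 : ℝ) * (1 / (2 * L) * ‖G‖ ^ 2) := by positivity
  have h9 : L / 2 * (‖y - xs‖ ^ 2 - 2 * η * inner ℝ G (y - z) + 2 * η * inner ℝ G (xs - z) +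
      η ^ 2 * ‖G‖ ^ 2) = L / 2 * ‖y - xs‖ ^ 2 - (k + 1) / 2 * inner ℝ G (y - z) +
      (k + 1) / 2 * inner ℝ G (xs - z) + (k + 1) ^ 2 / 4 * (1 / (2 * L) * ‖G‖ ^ 2) := by
    linear_combination (inner ℝ G (xs - z) - inner ℝ G (y - z)) * h1 + ‖G‖ ^ 2 * h2
  rw [h9] at h3
  linarith

/-- The sublinear rate, for any positive upper bound `L` of the eigenvalues. -/
lemma sublinear_rate_of_pos (hA : A.PosSemidef) (hΔ : 0 < Δ) (hL : 0 < L)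
    (hLu : ∀ x, inner ℝ x (A.toEuclideanLin x) ≤ L * ‖x‖ ^ 2)
    {xs : EuclideanSpace ℝ (Fin n)} (hxs : xs ∈ feasible n Δ)
    {x : ℕ → EuclideanSpace ℝ (Fin n)} (hx : IsLanczosRun A b Δ x) {k : ℕ} (hk : 1 ≤ k) :
    (k : ℝ) * (k + 1) / 2 * (quad A b (x k) - quad A b xs) ≤
      L * ‖xs‖ ^ 2 + quad A b 0 - quad A b xs := by
  set y : ℕ → EuclideanSpace ℝ (Fin n) := fun k => (krylov A b k).starProjection xs with hy
  have hyk : ∀ k, y k ∈ argminOn (fun w => ‖w - xs‖ ^ 2) (krylov A b k : Set _) :=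
    fun k => starProjection_mem_argminOn _ _
  suffices h : (k : ℝ) * (k + 1) / 4 * (quad A b (x k) - quad A b xs) + L / 2 * ‖y k - xs‖ ^ 2 ≤
      1 / 2 * (quad A b 0 - quad A b xs) + L / 2 * ‖xs‖ ^ 2 by
    have : 0 ≤ L / 2 * ‖y k - xs‖ ^ 2 := by positivity
    linarith
  induction k, hk using Nat.le_induction with
  | base =>
    -- The origin lies in `V_1` and is feasible, so it is a competitor for both `x_1` and `y_1`; the
    -- weight `1 · 2 / 4` gives the factor `1 / 2`.
    have h1 := (hx.2 1 le_rfl).2 0 ⟨Submodule.zero_mem _, by simpa using hΔ.le⟩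
    have h2 := (hyk 1).2 0 (Submodule.zero_mem _)
    simp only [zero_sub, norm_neg] at h2
    have h3 := mul_le_mul_of_nonneg_left h2 (show 0 ≤ L / 2 by positivity)
    push_cast
    linarith
  | succ k hk ih =>
    have := sublinear_rate_step hA hΔ hL hLu hxs (hx.2 k hk).1.1 (mem_feasible.2 (hx.2 k hk).1.2)
      (hx.2 (k + 1) (by lia)) (hyk k).1 (hyk (k + 1))
    refine le_trans (le_of_eq ?_) (this.trans ih)
    push_cast
    ring

lemma objective_of_mem_feasible {x : EuclideanSpace ℝ (Fin n)} (hx : x ∈ feasible n Δ) :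
    objective A b Δ x = quad A b x :=
  composite_indicatorFn_of_mem _ hx

lemma mem_feasible_of_mem_argminOn_objective (hΔ : 0 < Δ) {xs : EuclideanSpace ℝ (Fin n)}
    (hxs : xs ∈ argminOn (objective A b Δ) Set.univ) : xs ∈ feasible n Δ :=
  ((mem_argminOn_composite_indicatorFn_iff _ ⟨0, Set.mem_univ _, zero_mem_feasible n hΔ⟩ _).1 hxs).1.2

lemma IsLanczosRun.mem {x : ℕ → EuclideanSpace ℝ (Fin n)} (hΔ : 0 < Δ) (hx : IsLanczosRun A b Δ x)
    (k : ℕ) : x k ∈ krylov A b k ∧ x k ∈ feasible n Δ := by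
  cases k with
  | zero => rw [hx.1]; exact ⟨Submodule.zero_mem _, zero_mem_feasible n hΔ⟩
  | succ k => exact ⟨(hx.2 _ (by lia)).1.1, mem_feasible.2 (hx.2 _ (by lia)).1.2⟩

lemma IsLanczosRun.mem_argminOn_objective {x : ℕ → EuclideanSpace ℝ (Fin n)} (hΔ : 0 < Δ)
    (hx : IsLanczosRun A b Δ x) {k : ℕ} (hk : 1 ≤ k) :
    x k ∈ argminOn (objective A b Δ) (krylov A b k : Set _) := by
  refine (mem_argminOn_composite_indicatorFn_iff _
    ⟨0, Submodule.zero_mem _, zero_mem_feasible n hΔ⟩ _).2 ?_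
  simpa [argminOn, mem_feasible] using hx.2 k hk

lemma IsAuxiliary.isIdealizedRun (hA : A.PosSemidef) (hΔ : 0 < Δ) (hL : 0 < L)
    {xs : EuclideanSpace ℝ (Fin n)} {x y z : ℕ → EuclideanSpace ℝ (Fin n)}
    (hx : IsLanczosRun A b Δ x) (h : IsAuxiliary A b Δ L xs x y z) :
    IsIdealizedRun (quad A b) (indicatorFn (feasible n Δ)) L xs
      (fun k => (krylov A b k).toAffineSubspace) x y z where
  z_zero := h.z_zero
  M_one := by
    have hz : z 0 ∈ krylov A b 0 := by
      rw [h.z_zero]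
      exact (hx.mem hΔ 0).1
    refine mk'_span_le_toAffineSubspace (krylov_mono zero_le_one hz) ?_
    simpa using proxGrad_mem_krylov hA hΔ hL hz
  y_mem := h.y_mem
  x_mem k hk := hx.mem_argminOn_objective hΔ hk
  z_mem := h.z_mem
  z_inner := h.z_inner
  z_descent := h.z_descent
  M_succ k hk := by
    have hzk := krylov_mono k.le_succ (h.z_mem k hk)
    refine mk'_span_le_toAffineSubspace hzk ?_
    rw [Set.insert_subset_iff, Set.singleton_subset_iff]
    exact ⟨Submodule.sub_mem _ (krylov_mono k.le_succ (h.y_mem k hk).1) hzk,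
      proxGrad_mem_krylov hA hΔ hL (h.z_mem k hk)⟩

lemma exists_isAuxiliary_isIdealizedRunConvex (hA : A.PosSemidef) (hΔ : 0 < Δ) (hL : 0 < L)
    (hLu : ∀ x, inner ℝ x (A.toEuclideanLin x) ≤ L * ‖x‖ ^ 2)
    (xs : EuclideanSpace ℝ (Fin n)) {x : ℕ → EuclideanSpace ℝ (Fin n)}
    (hx : IsLanczosRun A b Δ x) :
    ∃ y z, IsAuxiliary A b Δ L xs x y z ∧
      IsIdealizedRunConvex (quad A b) (indicatorFn (feasible n Δ)) L xs
        (fun k => (krylov A b k).toAffineSubspace) x y z := by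
  set y : ℕ → EuclideanSpace ℝ (Fin n) := fun k => (krylov A b k).starProjection xs with hy
  have hyk : ∀ k, y k ∈ argminOn (fun w => ‖w - xs‖ ^ 2) (krylov A b k : Set _) :=
    fun k => starProjection_mem_argminOn _ _
  -- Index `0` needs no separate construction: `V_0` is trivial, which forces `y_0 = z_0 = 0 = x_0`.
  choose z hz hzy hzx hzd using fun k =>
    exists_auxiliary_point (b := b) hA hΔ hL hLu (hx.mem hΔ k).1 (hx.mem hΔ k).2 (hyk k).1
  have hbot : ∀ v ∈ krylov A b 0, v = 0 := by simp [krylov_zero]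
  have hz0 : z 0 = x 0 := by rw [hbot _ (hz 0), hx.1]
  have hy0 : y 0 = z 0 := by rw [hbot _ (hz 0), hbot _ (hyk 0).1]
  have haux : IsAuxiliary A b Δ L xs x y z := by
    refine ⟨hy0, hz0, fun k _ => hyk k, fun k _ => hz k, fun k _ => hzy k, fun k _ => ?_⟩
    rw [objective_of_mem_feasible (fbStep_mem_feasible b hΔ hL _),
      objective_of_mem_feasible (hx.mem hΔ k).2]
    exact_mod_cast hzd k
  have hrun := haux.isIdealizedRun hA hΔ hL hx
  refine ⟨y, z, haux, hrun.z_zero, hrun.M_one, hrun.y_mem, hrun.x_mem, hrun.z_mem, hrun.z_inner,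
    fun k _ => neg_nonpos.2 (hzx k), fun k _ => ?_, fun k _ => ?_, fun k _ => ?_⟩
  · refine mk'_span_le_toAffineSubspace (krylov_mono k.le_succ (hz k)) ?_
    simpa using proxGrad_mem_krylov hA hΔ hL (hz k)
  · refine mk'_span_le_toAffineSubspace (krylov_mono k.le_succ (hyk k).1) ?_
    simpa using proxGrad_mem_krylov hA hΔ hL (hz k)
  · refine mk'_span_le_toAffineSubspace (krylov_mono k.le_succ (hx.mem hΔ k).1) ?_
    simpa using proxGrad_mem_krylov hA hΔ hL (hx.mem hΔ k).1

/-- The sublinear rate; the bound `L` may vanish. -/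
lemma sublinear_rate (hA : A.PosSemidef) (hΔ : 0 < Δ)
    (hL : 0 ≤ L) (hLu : ∀ x, inner ℝ x (A.toEuclideanLin x) ≤ L * ‖x‖ ^ 2)
    {xs : EuclideanSpace ℝ (Fin n)} (hxs : xs ∈ feasible n Δ)
    {x : ℕ → EuclideanSpace ℝ (Fin n)} (hx : IsLanczosRun A b Δ x) {k : ℕ} (hk : 1 ≤ k) :
    quad A b (x k) - quad A b xs ≤
      2 * (L * ‖xs‖ ^ 2 + quad A b 0 - quad A b xs) / ((k : ℝ) * (k + 1)) := by
  have hk0 : (0 : ℝ) < k := by exact_mod_cast hk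
  rw [le_div_iff₀ (by positivity)]
  -- Every `L' > L` is a positive bound for the quadratic form, so the positive case applies;
  -- letting `L'` decrease to `L` includes `L = 0`, where the prox-gradient step of length `1 / L`
  -- makes no sense.
  have key : ∀ L', L < L' → (k : ℝ) * (k + 1) / 2 * (quad A b (x k) - quad A b xs) ≤
      L' * ‖xs‖ ^ 2 + quad A b 0 - quad A b xs := fun L' hL' =>
    sublinear_rate_of_pos hA hΔ (hL.trans_lt hL') (fun v => (hLu v).trans (by gcongr)) hxs hx hk
  have hlim : Filter.Tendsto (fun L' : ℝ => L' * ‖xs‖ ^ 2 + quad A b 0 - quad A b xs)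
      (nhdsWithin L (Set.Ioi L)) (nhds (L * ‖xs‖ ^ 2 + quad A b 0 - quad A b xs)) :=
    (Continuous.tendsto (by fun_prop) L).mono_left nhdsWithin_le_nhds
  have := ge_of_tendsto hlim (Filter.eventually_of_mem self_mem_nhdsWithin key)
  linarith

end Rates

end TrustRegion

theorem mainTheorem10 {n : ℕ} (A : Matrix (Fin n) (Fin n) ℝ) (hA : A.PosSemidef)
    (b : EuclideanSpace ℝ (Fin n)) (Δ : ℝ) (hΔ : 0 < Δ)
    (α L : ℝ)
    (hα : IsLeast {μ : ℝ | Module.End.HasEigenvalue (Matrix.toLin' A) μ} α)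
    (hL : IsGreatest {μ : ℝ | Module.End.HasEigenvalue (Matrix.toLin' A) μ} L)
    (xs : EuclideanSpace ℝ (Fin n))
    (hxs : xs ∈ TrustRegion.argminOn (TrustRegion.objective A b Δ) Set.univ)
    (x : ℕ → EuclideanSpace ℝ (Fin n)) (hx : TrustRegion.IsLanczosRun A b Δ x) :
    -- the method fits the idealized framework, in both versions, with `M_k = V_k`
    (0 < L →
      TrustRegion.IsCompositeProblem (TrustRegion.quad A b)
        (TrustRegion.indicatorFn (TrustRegion.feasible n Δ)) α L xs ∧
      (∃ y z, TrustRegion.IsAuxiliary A b Δ L xs x y z ∧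
        TrustRegion.IsIdealizedRunConvex (TrustRegion.quad A b)
          (TrustRegion.indicatorFn (TrustRegion.feasible n Δ)) L xs
          (fun k => (TrustRegion.krylov A b k).toAffineSubspace) x y z) ∧
      (∀ y z, TrustRegion.IsAuxiliary A b Δ L xs x y z →
        TrustRegion.IsIdealizedRun (TrustRegion.quad A b)
          (TrustRegion.indicatorFn (TrustRegion.feasible n Δ)) L xs
          (fun k => (TrustRegion.krylov A b k).toAffineSubspace) x y z)) ∧
    -- the values of `F` in the rates are finite
    (TrustRegion.objective A b Δ xs ≠ ⊤ ∧ TrustRegion.objective A b Δ xs ≠ ⊥) ∧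
    (∀ k, TrustRegion.objective A b Δ (x k) ≠ ⊤ ∧ TrustRegion.objective A b Δ (x k) ≠ ⊥) ∧
    -- linear rate
    (0 < α → ∀ y : ℕ → EuclideanSpace ℝ (Fin n),
      (∀ k, 1 ≤ k → y k ∈ TrustRegion.argminOn (fun w => ‖w - xs‖ ^ 2)
        (TrustRegion.krylov A b k : Set (EuclideanSpace ℝ (Fin n)))) →
      ∀ k, 1 ≤ k →
        ‖y (k + 1) - xs‖ ^ 2 + 2 * ((TrustRegion.objective A b Δ (x (k + 1))).toReal -
            (TrustRegion.objective A b Δ xs).toReal) / α ≤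
          (1 - √(α / L)) *
            (‖y k - xs‖ ^ 2 + 2 * ((TrustRegion.objective A b Δ (x k)).toReal -
              (TrustRegion.objective A b Δ xs).toReal) / α)) ∧
    -- sublinear rate
    (∀ k : ℕ, 1 ≤ k →
      (TrustRegion.objective A b Δ (x k)).toReal - (TrustRegion.objective A b Δ xs).toReal ≤
        2 * (L * ‖xs‖ ^ 2 + (TrustRegion.objective A b Δ 0).toReal -
          (TrustRegion.objective A b Δ xs).toReal) / ((k : ℝ) * ((k : ℝ) + 1))) := by
  have hxsf := TrustRegion.mem_feasible_of_mem_argminOn_objective hΔ hxs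
  have hLu := TrustRegion.inner_toEuclideanLin_le hA hL.2
  have hLα := TrustRegion.le_inner_toEuclideanLin hA hα.2
  have hL0 : 0 ≤ L := by
    obtain ⟨v, hv⟩ := hL.1.exists_hasEigenvector
    have h := TrustRegion.inner_toEuclideanLin_nonneg hA (WithLp.toLp 2 v)
    have hv' : A.toEuclideanLin (WithLp.toLp 2 v) = L • WithLp.toLp 2 v := by
      apply WithLp.ofLp_injective
      simpa using hv.apply_eq_smul
    have hpos : 0 < ‖(WithLp.toLp 2 v : EuclideanSpace ℝ (Fin n))‖ := by
      rw [norm_pos_iff]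
      simpa using hv.2
    rw [hv', real_inner_smul_right, real_inner_self_eq_norm_sq] at h
    exact nonneg_of_mul_nonneg_left h (by positivity)
  refine ⟨fun hL' => ⟨TrustRegion.isCompositeProblem_quad hA hΔ hL' hα.2 hL.2 hxs,
    TrustRegion.exists_isAuxiliary_isIdealizedRunConvex hA hΔ hL' hLu xs hx,
    fun y z h => h.isIdealizedRun hA hΔ hL' hx⟩, ?_, fun k => ?_, fun hα0 y hy k hk => ?_,
    fun k hk => ?_⟩
  · simp [TrustRegion.objective_of_mem_feasible hxsf]
  · simp [TrustRegion.objective_of_mem_feasible (hx.mem hΔ k).2]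
  · rw [TrustRegion.objective_of_mem_feasible hxsf,
      TrustRegion.objective_of_mem_feasible (hx.mem hΔ k).2,
      TrustRegion.objective_of_mem_feasible (hx.mem hΔ (k + 1)).2]
    exact TrustRegion.linear_rate_step hA hΔ hα0 (hL.2 hα.1) hLα hLu hxsf (hx.mem hΔ k).1
      (hx.mem hΔ k).2 (hx.2 (k + 1) (by lia)) (hy k hk).1 (hy (k + 1) (by lia))
  · rw [TrustRegion.objective_of_mem_feasible hxsf,
      TrustRegion.objective_of_mem_feasible (hx.mem hΔ k).2,
      TrustRegion.objective_of_mem_feasible (TrustRegion.zero_mem_feasible n hΔ)]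
    exact TrustRegion.sublinear_rate hA hΔ hL0 hLu hxsf hx hk
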